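/- For $0<\theta\le 1/3$ let $$s_\theta=\theta^{-2}\mathbf 1_{[0,\theta^3]}+(\theta^2+\theta+1)^{-1}\mathbf 1_{(\theta^3,1]},$$ which is a probability density with respect to Lebesgue measure $\mu$ on $[0,1]$, and let $\overline S=\{s_\theta : 0<\theta\le 1/3\}$. Write $\mathbb E_s$ for the expectation when $X_1,\dots,X_n$ are i.i.d. with density $s$, $h^2(t,u)=\frac12\int(\sqrt t-\sqrt u)^2\,d\mu$ for the squared Hellinger distance, and $\|\cdot\|$ for the norm of $\mathbb L_2(\mu)$. Then: 1. There is a constant $C<\infty$ such that for every $n\ge1$ there is an estimator $\hat s_n=\hat s_n(X_1,\dots,X_n)$, whose values are probability densities on $[0,1]$, with $$\sup_{0<\theta\le1/3}\mathbb E_{s_\theta}\left[n\,h^2(s_\theta,\hat s_n)\right]\le C.$$ 2. The set $\overline S$ has metric dimension bounded by $2$ in $\mathbb L_2(\mu)$, in the following sense: for every $\eta>0$ there is a set $S_\eta\subset\mathbb L_2(\mu)$ such that every $t\in\overline S$ is at distance at most $\eta$ from some point of $S_\eta$, and, for all $x\ge2$ and all $t\in\mathbb L_2(\mu)$, the open ball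 of center $t$ and radius $x\eta$ contains at most $\exp(2x^2)$ points of $S_\eta$. 3. Nevertheless, for every $n\ge1$ and every estimator $\tilde s_n=\tilde s_n(X_1,\dots,X_n)$, $$\sup_{0<\theta\le1/3}\mathbb E_{s_\theta}\left[\|s_\theta-\tilde s_n\|^2\right]=+\infty.$$ -/

import Mathlib

open MeasureTheory Set
open scoped ENNReal NNReal

noncomputable section

namespace DensityEstimation

/-- `N` is an `η`-net for `S` (the points of `N` need not belong to `S`). -/
def IsNet {M : Type*} [MetricSpace M] (N S : Set M) (η : ℝ) : Prop :=
  ∀ t ∈ S, ∃ t' ∈ N, dist t t' ≤ η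

/-- `S` has a metric dimension bounded by `D`: for every `η > 0` there is an `η`-net for `S` which
has at most `exp (D x²)` points in each open ball of the ambient space `M` of radius `x η`,
`x ≥ 2`. -/
def MetricDimLE {M : Type*} [MetricSpace M] (S : Set M) (D : ℝ) : Prop :=
  ∀ η : ℝ, 0 < η → ∃ N : Set M, IsNet N S η ∧
    ∀ x : ℝ, 2 ≤ x → ∀ t : M,
      (N ∩ Metric.ball t (x * η)).Finite ∧
        ((N ∩ Metric.ball t (x * η)).ncard : ℝ) ≤ Real.exp (D * x ^ 2)

section General

variable {X : Type*} [MeasurableSpace X]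

/-- `s` is a probability density with respect to `μ`. -/
structure IsDensity (μ : Measure X) (s : X → ℝ) : Prop where
  measurable : Measurable s
  nonneg : ∀ᵐ x ∂μ, 0 ≤ s x
  integrable : Integrable s μ
  integral_eq_one : ∫ x, s x ∂μ = 1

/-- The distribution `s · μ` of one observation with density `s`. -/
def law (μ : Measure X) (s : X → ℝ) : Measure X :=
  μ.withDensity fun x => ENNReal.ofReal (s x)

/-- The distribution of an i.i.d. sample `(X₁, …, Xₙ)` with density `s`. -/
def sampleLaw (μ : Measure X) (n : ℕ) (s : X → ℝ) : Measure (Fin n → X) :=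
  Measure.pi fun _ => law μ s

/-- An estimator based on `n` observations: a function `ŝ(ω)(x)` of the sample `ω` and of the
point `x`, jointly measurable. -/
def IsEstimator {n : ℕ} (shat : (Fin n → X) → X → ℝ) : Prop :=
  Measurable (Function.uncurry shat)

/-- The squared Hellinger distance `h²(t, u) = ½ ∫ (√t - √u)² dμ`. -/
def hellingerSq (μ : Measure X) (t u : X → ℝ) : ℝ≥0∞ :=
  (1 / 2) * ∫⁻ x, ENNReal.ofReal ((√(t x) - √(u x)) ^ 2) ∂μ

/-- The squared `L₂` distance `‖t - u‖² = ∫ (t - u)² dμ`; it is `∞` when `t - u` is not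
square integrable. -/
def l2DistSq (μ : Measure X) (t u : X → ℝ) : ℝ≥0∞ :=
  ∫⁻ x, ENNReal.ofReal ((t x - u x) ^ 2) ∂μ

/-- The risk `𝔼_s [ℓ(s, ŝ)]` of an estimator for the loss `ℓ`. -/
def risk (μ : Measure X) (loss : (X → ℝ) → (X → ℝ) → ℝ≥0∞) {n : ℕ}
    (shat : (Fin n → X) → X → ℝ) (s : X → ℝ) : ℝ≥0∞ :=
  ∫⁻ ω, loss s (shat ω) ∂(sampleLaw μ n s)

end General

/-- Lebesgue measure on `[0, 1]`. -/
def leb : Measure ℝ := volume.restrict (Icc 0 1)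

instance : IsProbabilityMeasure leb :=
  ⟨by simp [leb]⟩

/-- `s_θ = θ⁻² 1_{[0, θ³]} + (θ² + θ + 1)⁻¹ 1_{(θ³, 1]}`. -/
def s (θ : ℝ) (x : ℝ) : ℝ :=
  (Icc 0 (θ ^ 3)).indicator (fun _ => (θ ^ 2)⁻¹) x +
    (Ioc (θ ^ 3) 1).indicator (fun _ => (θ ^ 2 + θ + 1)⁻¹) x

theorem memLp_s (θ : ℝ) : MemLp (s θ) 2 leb :=
  ((memLp_const (θ ^ 2)⁻¹).indicator measurableSet_Icc).add
    ((memLp_const (θ ^ 2 + θ + 1)⁻¹).indicator measurableSet_Ioc)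

/-- The family `{s_θ : 0 < θ ≤ 1/3}` as a subset of the metric space `L₂([0, 1])`. -/
def familyL2 : Set (Lp ℝ 2 leb) :=
  (fun θ => (memLp_s θ).toLp (s θ)) '' Ioc 0 (1 / 3)

end DensityEstimation

end

namespace DensityEstimation

/-! The spike of `s θ`, of height `θ⁻²` on a length `θ³`, has mass `θ` but squared `L₂` norm `θ⁻¹`.
Hellinger distance sees the mass and `L₂` sees the norm, so the two losses behave oppositely as `θ →
0`.

Hellinger: `h²` is at most `8 |θ - φ|` (`hellingerSq_s_le`), so it suffices to estimate `θ` at rate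
`1/n`. In the coordinate `x ^ (1/3)` the mass grows at average rate at least `1` up to `θ` and at
most `1/3` beyond it, within `[0, 1/3]`. Maximizing a count penalized at an intermediate rate
locates `θ` on a grid of step `1/(3n)`, with exponential tails for the index error
(`sampleLaw_best_eq_le`).

Dimension: the squared `L₂` distance is comparable with `|θ⁻¹ - φ⁻¹|` (`dist_sq_toLp_s_bounds`). The
family thus looks like `[3, ∞)` with the square root of the usual distance, and equally spaced
values of `θ⁻¹` form the net.

`L₂` risk: all sample laws dominate one fixed nonzero measure, under which an estimator would have
to approximate both `s (1/3)` and `s φ`, whose distance tends to infinity as `φ → 0`. -/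

/-! ### Values and integrals of the densities. -/

theorem s_eq_first {θ x : ℝ} (hx : x ∈ Icc 0 (θ ^ 3)) : s θ x = (θ ^ 2)⁻¹ := by
  have h : x ∉ Ioc (θ ^ 3) 1 := fun h => absurd h.1 (not_lt.2 hx.2)
  simp only [s, indicator_of_mem hx, indicator_of_notMem h, add_zero]

theorem s_eq_second {θ x : ℝ} (hx : x ∈ Ioc (θ ^ 3) 1) : s θ x = (θ ^ 2 + θ + 1)⁻¹ := by
  have h : x ∉ Icc 0 (θ ^ 3) := fun h => absurd hx.1 (not_lt.2 h.2)
  simp only [s, indicator_of_mem hx, indicator_of_notMem h, zero_add]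

/-- Joint measurability makes `s` with an estimated parameter an estimator. -/
theorem measurable_uncurry_s : Measurable (Function.uncurry s) := by
  have h1 : MeasurableSet {p : ℝ × ℝ | p.2 ∈ Icc 0 (p.1 ^ 3)} :=
    (measurableSet_le measurable_const measurable_snd).inter
      (measurableSet_le measurable_snd (measurable_fst.pow_const 3))
  have h2 : MeasurableSet {p : ℝ × ℝ | p.2 ∈ Ioc (p.1 ^ 3) 1} :=
    (measurableSet_lt (measurable_fst.pow_const 3) measurable_snd).inter
      (measurableSet_le measurable_snd measurable_const)
  have h3 : Measurable fun p : ℝ × ℝ => (p.1 ^ 2)⁻¹ := by fun_prop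
  have h4 : Measurable fun p : ℝ × ℝ => (p.1 ^ 2 + p.1 + 1)⁻¹ := by fun_prop
  exact (h3.indicator h1).add (h4.indicator h2)

theorem measurable_s (θ : ℝ) : Measurable (s θ) :=
  (measurable_const.indicator measurableSet_Icc).add (measurable_const.indicator measurableSet_Ioc)

theorem leb_Ioc {a b : ℝ} (ha : 0 ≤ a) (hb : b ≤ 1) : leb (Ioc a b) = ENNReal.ofReal (b - a) := by
  rw [leb, Measure.restrict_apply measurableSet_Ioc,
    inter_eq_left.2 (Ioc_subset_Icc_self.trans (Icc_subset_Icc ha hb)), Real.volume_Ioc]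

theorem leb_Icc {b : ℝ} (hb : b ≤ 1) : leb (Icc 0 b) = ENNReal.ofReal b := by
  rw [leb, Measure.restrict_apply measurableSet_Icc,
    inter_eq_left.2 (Icc_subset_Icc le_rfl hb), Real.volume_Icc, sub_zero]

/-- Integrals of functions of two members of the family, which are constant on three intervals. -/
theorem lintegral_s_s {θ φ : ℝ} (hφ : 0 < φ) (hφθ : φ ≤ θ) (hθ : θ ≤ 1) (F : ℝ → ℝ → ℝ)
    (hF : ∀ a b, 0 ≤ F a b) :
    ∫⁻ x, ENNReal.ofReal (F (s θ x) (s φ x)) ∂leb = ENNReal.ofReal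
      (φ ^ 3 * F (θ ^ 2)⁻¹ (φ ^ 2)⁻¹ + (θ ^ 3 - φ ^ 3) * F (θ ^ 2)⁻¹ (φ ^ 2 + φ + 1)⁻¹ +
        (1 - θ ^ 3) * F (θ ^ 2 + θ + 1)⁻¹ (φ ^ 2 + φ + 1)⁻¹) := by
  have hφ3 : 0 ≤ φ ^ 3 := by positivity
  have h3 : φ ^ 3 ≤ θ ^ 3 := by gcongr
  have hθ3 : θ ^ 3 ≤ 1 := pow_le_one₀ (hφ.le.trans hφθ) hθ
  have hae : ∀ᵐ x ∂leb, ENNReal.ofReal (F (s θ x) (s φ x)) =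
      (Icc 0 (φ ^ 3)).indicator (fun _ => ENNReal.ofReal (F (θ ^ 2)⁻¹ (φ ^ 2)⁻¹)) x +
      (Ioc (φ ^ 3) (θ ^ 3)).indicator
        (fun _ => ENNReal.ofReal (F (θ ^ 2)⁻¹ (φ ^ 2 + φ + 1)⁻¹)) x +
      (Ioc (θ ^ 3) 1).indicator
        (fun _ => ENNReal.ofReal (F (θ ^ 2 + θ + 1)⁻¹ (φ ^ 2 + φ + 1)⁻¹)) x := by
    refine (ae_restrict_mem measurableSet_Icc).mono fun x hx => ?_
    simp only [indicator_apply, mem_Icc, mem_Ioc]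
    rcases le_or_gt x (φ ^ 3) with h | h
    · rw [s_eq_first ⟨hx.1, h⟩, s_eq_first ⟨hx.1, h.trans h3⟩]
      simp [hx.1, h, h.not_gt, (h.trans h3).not_gt]
    · rcases le_or_gt x (θ ^ 3) with h' | h'
      · rw [s_eq_second ⟨h, hx.2⟩, s_eq_first ⟨hx.1, h'⟩]
        simp [h, h', h.not_ge, h'.not_gt]
      · rw [s_eq_second ⟨h, hx.2⟩, s_eq_second ⟨h', hx.2⟩]
        simp [hx.2, h', h.not_ge, h'.not_ge]
  rw [lintegral_congr_ae hae, lintegral_add_right _ (measurable_const.indicator measurableSet_Ioc),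
    lintegral_add_right _ (measurable_const.indicator measurableSet_Ioc),
    lintegral_indicator_const measurableSet_Icc, lintegral_indicator_const measurableSet_Ioc,
    lintegral_indicator_const measurableSet_Ioc, leb_Icc (h3.trans hθ3), leb_Ioc hφ3 hθ3,
    leb_Ioc (hφ3.trans h3) le_rfl, ← ENNReal.ofReal_mul (hF _ _), ← ENNReal.ofReal_mul (hF _ _),
    ← ENNReal.ofReal_mul (hF _ _), ← ENNReal.ofReal_add, ← ENNReal.ofReal_add]
  · congr 1; ring
  all_goals have := hF; have := sub_nonneg.2 h3; have := sub_nonneg.2 hθ3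
  · exact add_nonneg (mul_nonneg (hF _ _) hφ3) (mul_nonneg (hF _ _) ‹_›)
  · exact mul_nonneg (hF _ _) ‹_›
  · exact mul_nonneg (hF _ _) hφ3
  · exact mul_nonneg (hF _ _) ‹_›

theorem s_nonneg {θ : ℝ} (hθ : 0 < θ) (x : ℝ) : 0 ≤ s θ x :=
  add_nonneg (indicator_nonneg (fun _ _ => by positivity) x)
    (indicator_nonneg (fun _ _ => by positivity) x)

theorem lintegral_s {θ : ℝ} (hθ : 0 < θ) (hθ1 : θ ≤ 1) :
    ∫⁻ x, ENNReal.ofReal (s θ x) ∂leb = 1 := by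
  -- Taking `φ = θ` empties the middle interval; the absolute value is there because `F` must be
  -- nonnegative on all reals.
  have h := lintegral_s_s hθ le_rfl hθ1 (fun a _ => |a|) (fun a _ => abs_nonneg a)
  simp only [abs_of_nonneg (s_nonneg hθ _)] at h
  have h1 : 0 ≤ (θ ^ 2)⁻¹ := by positivity
  have h2 : 0 ≤ (θ ^ 2 + θ + 1)⁻¹ := by positivity
  have h3 : θ ^ 2 + θ + 1 ≠ 0 := by positivity
  rw [h, abs_of_nonneg h1, abs_of_nonneg h2, ← ENNReal.ofReal_one]
  congr 1
  field_simp
  ring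

theorem isDensity_s {θ : ℝ} (hθ : 0 < θ) (hθ1 : θ ≤ 1) : IsDensity leb (s θ) where
  measurable := measurable_s θ
  nonneg := Filter.Eventually.of_forall (s_nonneg hθ)
  integrable := (memLp_s θ).integrable (by norm_num)
  integral_eq_one := by
    rw [integral_eq_lintegral_of_nonneg_ae (Filter.Eventually.of_forall (s_nonneg hθ))
      (measurable_s θ).aestronglyMeasurable, lintegral_s hθ hθ1, ENNReal.toReal_one]

/-! ### Hellinger distance within the family. -/

theorem hellingerSq_comm {X : Type*} [MeasurableSpace X] (μ : Measure X) (t u : X → ℝ) :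
    hellingerSq μ t u = hellingerSq μ u t := by
  simp only [hellingerSq, sub_sq_comm]

theorem sq_sqrt_sub_sqrt_le {a b : ℝ} (ha : 0 ≤ a) (hab : a ≤ b) : (√a - √b) ^ 2 ≤ b - a := by
  have h1 := Real.sq_sqrt ha
  have h2 := Real.sq_sqrt (ha.trans hab)
  nlinarith [Real.sqrt_nonneg a, Real.sqrt_le_sqrt hab]

/-- By `(√a - √b)² ≤ |a - b|`, the three intervals of constancy contribute at most `2`, `3` and `3`
times `θ - φ`; the factor `1/2` is discarded. -/
theorem hellingerSq_s_le_of_le {θ φ : ℝ} (hφ : 0 < φ) (hφθ : φ ≤ θ) (hθ : θ ≤ 1) :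
    hellingerSq leb (s θ) (s φ) ≤ ENNReal.ofReal (8 * (θ - φ)) := by
  have hθ0 := hφ.trans_le hφθ
  rw [hellingerSq, lintegral_s_s hφ hφθ hθ (fun a b => (√a - √b) ^ 2) (fun _ _ => sq_nonneg _)]
  refine (mul_le_of_le_one_left' (by norm_num)).trans (ENNReal.ofReal_le_ofReal ?_)
  have h3 : φ ^ 3 ≤ θ ^ 3 := by gcongr
  have hθ3 : θ ^ 3 ≤ 1 := pow_le_one₀ hθ0.le hθ
  have hc : (φ ^ 2 + φ + 1)⁻¹ ≤ 1 := inv_le_one_of_one_le₀ (by nlinarith)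
  have hc' : (1 : ℝ) ≤ (θ ^ 2)⁻¹ := (one_le_inv₀ (by positivity)).2 (by nlinarith)
  have A := sq_sqrt_sub_sqrt_le (a := (θ ^ 2)⁻¹) (b := (φ ^ 2)⁻¹) (by positivity) (by gcongr)
  have B := sq_sqrt_sub_sqrt_le (a := (φ ^ 2 + φ + 1)⁻¹) (b := (θ ^ 2)⁻¹) (by positivity)
    (hc.trans hc')
  have C := sq_sqrt_sub_sqrt_le (a := (θ ^ 2 + θ + 1)⁻¹) (b := (φ ^ 2 + φ + 1)⁻¹) (by positivity)
    (by gcongr)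
  rw [sub_sq_comm] at B
  have hB0 : 0 ≤ (φ ^ 2 + φ + 1)⁻¹ := by positivity
  have A' : φ ^ 3 * (√(θ ^ 2)⁻¹ - √(φ ^ 2)⁻¹) ^ 2 ≤ 2 * (θ - φ) := by
    refine (mul_le_mul_of_nonneg_left A (by positivity)).trans ?_
    have : φ ^ 3 * ((φ ^ 2)⁻¹ - (θ ^ 2)⁻¹) = (φ / θ) * (1 + φ / θ) * (θ - φ) := by
      field_simp; ring
    rw [this]
    have hr : φ / θ ≤ 1 := (div_le_one hθ0).2 hφθ
    have : 0 ≤ φ / θ := by positivity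
    gcongr
    nlinarith
  have B' : (θ ^ 3 - φ ^ 3) * (√(θ ^ 2)⁻¹ - √(φ ^ 2 + φ + 1)⁻¹) ^ 2 ≤ 3 * (θ - φ) := by
    refine (mul_le_mul_of_nonneg_left (B.trans (sub_le_self _ hB0)) (by linarith)).trans ?_
    have : (θ ^ 3 - φ ^ 3) * (θ ^ 2)⁻¹ = (1 + φ / θ + (φ / θ) ^ 2) * (θ - φ) := by
      field_simp; ring
    rw [this]
    have hr : φ / θ ≤ 1 := (div_le_one hθ0).2 hφθ
    have : 0 ≤ φ / θ := by positivity
    gcongr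
    nlinarith
  have C' : (1 - θ ^ 3) * (√(θ ^ 2 + θ + 1)⁻¹ - √(φ ^ 2 + φ + 1)⁻¹) ^ 2 ≤ 3 * (θ - φ) := by
    refine (mul_le_of_le_one_left (sq_nonneg _) (by nlinarith [pow_pos hθ0 3])).trans (C.trans ?_)
    rw [inv_sub_inv (by positivity) (by positivity)]
    refine (div_le_self (by nlinarith) ?_).trans (by nlinarith)
    nlinarith [mul_pos hφ hθ0, mul_pos (pow_pos hφ 2) (pow_pos hθ0 2),
      mul_pos (pow_pos hφ 2) hθ0, mul_pos hφ (pow_pos hθ0 2)]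
  linarith

theorem hellingerSq_s_le {θ φ : ℝ} (hθ : θ ∈ Ioc 0 1) (hφ : φ ∈ Ioc 0 1) :
    hellingerSq leb (s θ) (s φ) ≤ ENNReal.ofReal (8 * |θ - φ|) := by
  rcases le_total φ θ with h | h
  · rw [abs_of_nonneg (sub_nonneg.2 h)]
    exact hellingerSq_s_le_of_le hφ.1 h hθ.2
  · rw [abs_sub_comm, abs_of_nonneg (sub_nonneg.2 h), hellingerSq_comm]
    exact hellingerSq_s_le_of_le hθ.1 h hφ.2

/-! ### `L₂` distance within the family. -/

theorem dist_sq_toLp_s {θ φ : ℝ} (hφ : 0 < φ) (hφθ : φ ≤ θ) (hθ : θ ≤ 1) :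
    dist ((memLp_s θ).toLp (s θ)) ((memLp_s φ).toLp (s φ)) ^ 2 =
      φ ^ 3 * ((θ ^ 2)⁻¹ - (φ ^ 2)⁻¹) ^ 2 + (θ ^ 3 - φ ^ 3) * ((θ ^ 2)⁻¹ - (φ ^ 2 + φ + 1)⁻¹) ^ 2 +
        (1 - θ ^ 3) * ((θ ^ 2 + θ + 1)⁻¹ - (φ ^ 2 + φ + 1)⁻¹) ^ 2 := by
  have h1 := eLpNorm_nnreal_pow_eq_lintegral (f := s θ - s φ) (μ := leb) (p := 2) two_ne_zero
  have h2 : ∀ x, ‖(s θ - s φ) x‖ₑ ^ ((2 : ℝ≥0) : ℝ) = ENNReal.ofReal ((s θ x - s φ x) ^ 2) := by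
    intro x
    rw [← sq_abs, ENNReal.ofReal_pow (abs_nonneg _), ← Real.enorm_eq_ofReal_abs]
    simp
  simp only [h2] at h1
  rw [lintegral_s_s hφ hφθ hθ (fun a b => (a - b) ^ 2) (fun _ _ => sq_nonneg _)] at h1
  rw [dist_edist, Lp.edist_toLp_toLp, ← ENNReal.toReal_pow]
  have h3 : φ ^ 3 ≤ θ ^ 3 := by gcongr
  have hθ3 : θ ^ 3 ≤ 1 := pow_le_one₀ (hφ.le.trans hφθ) hθ
  have := sub_nonneg.2 h3
  have := sub_nonneg.2 hθ3
  refine Eq.trans ?_ (ENNReal.toReal_ofReal (by positivity))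
  rw [← h1]
  simp

/-- With `r = φ / θ`, these polynomials are the contributions of `[0, φ³]` and `(φ³, θ³]` to the
squared distance, in units of `φ⁻¹ - θ⁻¹`. The first vanishes at `r = 1` and the second at `r = 0`,
so only their sum is bounded below. -/
theorem one_sub_mul_one_add_sq_bounds {r : ℝ} (hr0 : 0 ≤ r) (hr : r ≤ 1) :
    (1 - r) * (1 + r) ^ 2 ≤ 4 ∧ r * (1 + r + r ^ 2) ≤ 3 ∧
      1 / 2 ≤ (1 - r) * (1 + r) ^ 2 + 64 / 81 * (r * (1 + r + r ^ 2)) := by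
  have h2 : r ^ 2 ≤ r := by nlinarith
  have h3 : r ^ 3 ≤ r ^ 2 := by nlinarith
  have h3' : 0 ≤ r ^ 3 := by positivity
  refine ⟨?_, ?_, ?_⟩ <;> ring_nf <;> nlinarith

theorem dist_sq_toLp_s_bounds_of_le {θ φ : ℝ} (hφ : 0 < φ) (hφθ : φ ≤ θ) (hθ : θ ≤ 1 / 3) :
    (φ⁻¹ - θ⁻¹) / 2 ≤ dist ((memLp_s θ).toLp (s θ)) ((memLp_s φ).toLp (s φ)) ^ 2 ∧
      dist ((memLp_s θ).toLp (s θ)) ((memLp_s φ).toLp (s φ)) ^ 2 ≤ 8 * (φ⁻¹ - θ⁻¹) := by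
  have hθ0 := hφ.trans_le hφθ
  rw [dist_sq_toLp_s hφ hφθ (by linarith)]
  have hr : φ / θ ≤ 1 := (div_le_one hθ0).2 hφθ
  have hr0 : 0 < φ / θ := by positivity
  have hv : 0 ≤ φ⁻¹ - θ⁻¹ := sub_nonneg.2 (by gcongr)
  have h3 : 0 ≤ θ ^ 3 - φ ^ 3 := sub_nonneg.2 (by gcongr)
  have hc : (φ ^ 2 + φ + 1)⁻¹ ≤ 1 := inv_le_one_of_one_le₀ (by nlinarith)
  have hc0 : 0 < (φ ^ 2 + φ + 1)⁻¹ := by positivity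
  have hc0' : 0 < (θ ^ 2 + θ + 1)⁻¹ := by positivity
  have hcc : (θ ^ 2 + θ + 1)⁻¹ ≤ (φ ^ 2 + φ + 1)⁻¹ := by gcongr
  have hθ2 : (9 : ℝ) ≤ (θ ^ 2)⁻¹ := by
    rw [le_inv_comm₀ (by norm_num) (by positivity)]; nlinarith
  have e1 : φ ^ 3 * ((θ ^ 2)⁻¹ - (φ ^ 2)⁻¹) ^ 2 =
      (φ⁻¹ - θ⁻¹) * ((1 - φ / θ) * (1 + φ / θ) ^ 2) := by
    field_simp; ring
  have e2 : (θ ^ 3 - φ ^ 3) * ((θ ^ 2)⁻¹) ^ 2 =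
      (φ⁻¹ - θ⁻¹) * ((φ / θ) * (1 + φ / θ + (φ / θ) ^ 2)) := by
    field_simp; ring
  have u2 : (θ ^ 3 - φ ^ 3) * ((θ ^ 2)⁻¹ - (φ ^ 2 + φ + 1)⁻¹) ^ 2 ≤
      (θ ^ 3 - φ ^ 3) * ((θ ^ 2)⁻¹) ^ 2 := by
    gcongr
    · linarith
    · linarith
  -- The subtracted value is at most `1`, hence at most `θ⁻² / 9`; this gives the factor `64 / 81 =
  -- (8 / 9)²`.
  have l2 : (θ ^ 3 - φ ^ 3) * (8 / 9 * (θ ^ 2)⁻¹) ^ 2 ≤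
      (θ ^ 3 - φ ^ 3) * ((θ ^ 2)⁻¹ - (φ ^ 2 + φ + 1)⁻¹) ^ 2 := by
    gcongr
    linarith
  have u3 : (1 - θ ^ 3) * ((θ ^ 2 + θ + 1)⁻¹ - (φ ^ 2 + φ + 1)⁻¹) ^ 2 ≤ φ⁻¹ - θ⁻¹ := by
    refine (mul_le_of_le_one_left (sq_nonneg _) (by nlinarith [pow_pos hθ0 3])).trans ?_
    rw [sub_sq_comm]
    calc ((φ ^ 2 + φ + 1)⁻¹ - (θ ^ 2 + θ + 1)⁻¹) ^ 2
        ≤ (φ ^ 2 + φ + 1)⁻¹ - (θ ^ 2 + θ + 1)⁻¹ := by nlinarith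
      _ ≤ 3 * (θ - φ) := by
        rw [inv_sub_inv (by positivity) (by positivity)]
        refine (div_le_self (by nlinarith) ?_).trans (by nlinarith)
        nlinarith [mul_pos hφ hθ0, mul_pos (pow_pos hφ 2) (pow_pos hθ0 2),
          mul_pos (pow_pos hφ 2) hθ0, mul_pos hφ (pow_pos hθ0 2)]
      _ = (3 * θ * φ) * (φ⁻¹ - θ⁻¹) := by field_simp
      _ ≤ φ⁻¹ - θ⁻¹ := mul_le_of_le_one_left hv (by nlinarith)
  have l3 : 0 ≤ (1 - θ ^ 3) * ((θ ^ 2 + θ + 1)⁻¹ - (φ ^ 2 + φ + 1)⁻¹) ^ 2 :=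
    mul_nonneg (sub_nonneg.2 (pow_le_one₀ hθ0.le (by linarith))) (sq_nonneg _)
  rw [mul_pow, mul_left_comm, e2] at l2
  rw [e2] at u2
  rw [e1]
  generalize φ / θ = r at *
  obtain ⟨b1, b2, b3⟩ := one_sub_mul_one_add_sq_bounds hr0.le hr
  have := mul_le_mul_of_nonneg_left b1 hv
  have := mul_le_mul_of_nonneg_left b2 hv
  have := mul_le_mul_of_nonneg_left b3 hv
  -- The upper constant is `8 = 4 + 3 + 1`, one term for each interval.
  constructor <;> linarith

theorem dist_sq_toLp_s_bounds {θ φ : ℝ} (hθ : θ ∈ Ioc 0 (1 / 3)) (hφ : φ ∈ Ioc 0 (1 / 3)) :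
    |θ⁻¹ - φ⁻¹| / 2 ≤ dist ((memLp_s θ).toLp (s θ)) ((memLp_s φ).toLp (s φ)) ^ 2 ∧
      dist ((memLp_s θ).toLp (s θ)) ((memLp_s φ).toLp (s φ)) ^ 2 ≤ 8 * |θ⁻¹ - φ⁻¹| := by
  rcases le_total φ θ with h | h
  · have : θ⁻¹ ≤ φ⁻¹ := inv_anti₀ hφ.1 h
    rw [abs_sub_comm, abs_of_nonneg (sub_nonneg.2 this)]
    exact dist_sq_toLp_s_bounds_of_le hφ.1 h hθ.2
  · have : φ⁻¹ ≤ θ⁻¹ := inv_anti₀ hθ.1 h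
    rw [dist_comm, abs_of_nonneg (sub_nonneg.2 this)]
    exact dist_sq_toLp_s_bounds_of_le hθ.1 h hφ.2

/-! ### Metric dimension. -/

/-- A set of naturals of diameter at most `d` has at most `d + 1` elements. -/
theorem finite_and_ncard_le_of_forall_sub_le {J : Set ℕ} {d : ℝ} (hd : 0 ≤ d)
    (hJ : ∀ i ∈ J, ∀ j ∈ J, (i : ℝ) - j ≤ d) : J.Finite ∧ (J.ncard : ℝ) ≤ d + 1 := by
  rcases J.eq_empty_or_nonempty with rfl | hne
  · simpa using by positivity
  · have hsub : J ⊆ ↑(Finset.Icc (sInf J) (sInf J + ⌊d⌋₊)) := by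
      intro i hi
      rw [Finset.coe_Icc]
      refine ⟨Nat.sInf_le hi, ?_⟩
      have h := hJ i hi _ (Nat.sInf_mem hne)
      rw [← tsub_le_iff_left]
      refine Nat.le_floor ?_
      rwa [Nat.cast_sub (Nat.sInf_le hi)]
    refine ⟨(Finset.finite_toSet _).subset hsub, ?_⟩
    have h := ncard_le_ncard hsub (Finset.finite_toSet _)
    rw [ncard_coe_finset, Nat.card_Icc] at h
    have h2 : J.ncard ≤ ⌊d⌋₊ + 1 := by omega
    have h3 : (J.ncard : ℝ) ≤ ⌊d⌋₊ + 1 := by exact_mod_cast h2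
    linarith [Nat.floor_le hd]

theorem sixtyFour_mul_sq_add_one_le_exp {x : ℝ} (hx : 2 ≤ x) :
    64 * x ^ 2 + 1 ≤ Real.exp (2 * x ^ 2) := by
  have h1 : Real.exp 8 = Real.exp 1 ^ 8 := by rw [← Real.exp_nat_mul]; norm_num
  have h3 : (2.7 : ℝ) ^ 8 ≤ Real.exp 8 := by
    rw [h1]
    gcongr
    linarith [Real.exp_one_gt_d9]
  have h4 : Real.exp (2 * x ^ 2) = Real.exp 8 * Real.exp (2 * x ^ 2 - 8) := by
    rw [← Real.exp_add]; ring_nf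
  have h5 := Real.add_one_le_exp (2 * x ^ 2 - 8)
  have h6 : 4 ≤ x ^ 2 := by nlinarith
  rw [h4]
  calc 64 * x ^ 2 + 1 ≤ 2.7 ^ 8 * (2 * x ^ 2 - 8 + 1) := by norm_num; linarith
    _ ≤ _ := by gcongr; linarith

theorem metricDimLE_familyL2 : MetricDimLE familyL2 2 := by
  intro η hη
  -- Rounding `θ⁻¹` down to the grid `3 + jδ` costs a squared distance of at most `8δ = η²`.
  set δ : ℝ := η ^ 2 / 8 with hδ
  have hδ0 : 0 < δ := by positivity
  let p : ℕ → ℝ := fun j => (3 + j * δ)⁻¹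
  have hp : ∀ j, p j ∈ Ioc 0 (1 / 3) := fun j => by
    refine ⟨by positivity, ?_⟩
    rw [one_div]
    exact inv_anti₀ (by norm_num) (le_add_of_nonneg_right (by positivity))
  let f : ℕ → Lp ℝ 2 leb := fun j => (memLp_s (p j)).toLp (s (p j))
  refine ⟨range f, ?_, fun x hx t => ?_⟩
  · rintro _ ⟨θ, hθ, rfl⟩
    have hv : 3 ≤ θ⁻¹ := by
      rw [le_inv_comm₀ (by norm_num) hθ.1]; simpa using hθ.2
    have hv' : 0 ≤ (θ⁻¹ - 3) / δ := div_nonneg (by linarith) hδ0.le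
    refine ⟨_, ⟨⌊(θ⁻¹ - 3) / δ⌋₊, rfl⟩, ?_⟩
    have h1 := (le_div_iff₀ hδ0).1 (Nat.floor_le hv')
    have h2 := (div_lt_iff₀ hδ0).1 (Nat.lt_floor_add_one ((θ⁻¹ - 3) / δ))
    refine (sq_le_sq₀ dist_nonneg hη.le).1 (((dist_sq_toLp_s_bounds hθ (hp _)).2).trans ?_)
    have h3 : |θ⁻¹ - (p ⌊(θ⁻¹ - 3) / δ⌋₊)⁻¹| ≤ δ := by
      simp only [p, inv_inv]
      rw [abs_le]
      constructor <;> linarith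
    linarith
  · set J : Set ℕ := f ⁻¹' Metric.ball t (x * η) with hJdef
    have himg : range f ∩ Metric.ball t (x * η) = f '' J := by
      rw [hJdef, image_preimage_eq_range_inter]
    -- Two net points in the ball satisfy `|i - j| δ / 2 ≤ (2xη)² = 32 x² δ`.
    have hJ : ∀ i ∈ J, ∀ j ∈ J, (i : ℝ) - j ≤ 64 * x ^ 2 := by
      intro i hi j hj
      have h1 : dist (f i) (f j) ≤ 2 * (x * η) :=
        (dist_triangle_right _ _ t).trans (by
          rw [two_mul]; exact add_le_add (Metric.mem_ball.1 hi).le (Metric.mem_ball.1 hj).le)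
      have h2 : dist (f i) (f j) ^ 2 ≤ (2 * (x * η)) ^ 2 := by gcongr
      have h3 := (dist_sq_toLp_s_bounds (hp i) (hp j)).1.trans h2
      simp only [p, inv_inv] at h3
      have h4 := le_abs_self (3 + (i : ℝ) * δ - (3 + j * δ))
      have h5 : ((i : ℝ) - j) * δ ≤ 64 * x ^ 2 * δ := by rw [hδ] at *; nlinarith
      exact le_of_mul_le_mul_right h5 hδ0
    obtain ⟨hfin, hcard⟩ := finite_and_ncard_le_of_forall_sub_le (by positivity) hJ
    rw [himg]
    refine ⟨hfin.image f, ?_⟩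
    have : ((f '' J).ncard : ℝ) ≤ J.ncard := by exact_mod_cast ncard_image_le hfin
    exact this.trans (hcard.trans (sixtyFour_mul_sq_add_one_le_exp hx))

/-! ### Infinite `L₂` risk. -/

/-- The product outer measure is the largest one bounded on boxes by the products of the side
masses, so it is monotone in the factors. -/
theorem pi_mono_measure {ι : Type*} [Fintype ι] {α : ι → Type*} [∀ i, MeasurableSpace (α i)]
    {μ ν : ∀ i, Measure (α i)} [∀ i, SigmaFinite (μ i)] (h : ∀ i, μ i ≤ ν i) :
    Measure.pi μ ≤ Measure.pi ν := by
  rw [Measure.le_iff]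
  intro t ht
  rw [Measure.pi, Measure.pi, toMeasure_apply _ _ ht, toMeasure_apply _ _ ht]
  refine (OuterMeasure.le_pi.2 fun u _ => ?_ : (_ : OuterMeasure (∀ i, α i)) ≤ _) t
  refine (OuterMeasure.pi_pi_le _ u).trans ?_
  exact Finset.prod_le_prod' fun i _ => h i (u i)

theorem isProbabilityMeasure_law {θ : ℝ} (hθ : 0 < θ) (hθ1 : θ ≤ 1) :
    IsProbabilityMeasure (law leb (s θ)) :=
  ⟨by rw [law, withDensity_apply _ MeasurableSet.univ, Measure.restrict_univ, lintegral_s hθ hθ1]⟩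

/-- A common lower bound for all the laws. -/
noncomputable def commonPart : Measure ℝ := ENNReal.ofReal (1 / 2) • leb.restrict (Ioc (1 / 27) 1)

instance : IsFiniteMeasure commonPart := 
  Measure.smul_finite _ ENNReal.ofReal_ne_top

theorem commonPart_univ_ne_zero : commonPart univ ≠ 0 := by
  rw [commonPart, Measure.smul_apply, Measure.restrict_apply_univ,
    leb_Ioc (by norm_num) le_rfl, smul_eq_mul, ← ENNReal.ofReal_mul (by norm_num)]
  simp only [ne_eq, ENNReal.ofReal_eq_zero]
  norm_num

/-- Since `θ³ ≤ 1/27`, the spike misses `(1/27, 1]`, where the density is at least `9/13 > 1/2`. -/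
theorem commonPart_le_law {θ : ℝ} (hθ : θ ∈ Ioc 0 (1 / 3)) : commonPart ≤ law leb (s θ) := by
  have h0 := hθ.1
  rw [Measure.le_iff]
  intro A hA
  rw [law, withDensity_apply _ hA, commonPart, Measure.smul_apply, Measure.restrict_apply hA,
    smul_eq_mul, ← setLIntegral_const]
  refine (setLIntegral_mono' (hA.inter measurableSet_Ioc) fun x hx => ?_).trans
    (lintegral_mono_set inter_subset_left)
  have h3 : θ ^ 3 ≤ 1 / 27 := by
    have : θ ^ 3 ≤ (1 / 3) ^ 3 := by gcongr; exact hθ.2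
    linarith
  rw [s_eq_second ⟨h3.trans_lt hx.2.1, hx.2.2⟩]
  refine ENNReal.ofReal_le_ofReal ?_
  rw [one_div]
  have := hθ.2
  gcongr
  nlinarith

/-- With a reference measure free of `θ`, the risks at two parameters can be added under one
integral. -/
theorem lintegral_commonPart_le_risk {n : ℕ} (loss : (ℝ → ℝ) → (ℝ → ℝ) → ℝ≥0∞)
    (shat : (Fin n → ℝ) → ℝ → ℝ) {θ : ℝ} (hθ : θ ∈ Ioc 0 (1 / 3)) :
    ∫⁻ ω, loss (s θ) (shat ω) ∂(Measure.pi fun _ : Fin n => commonPart) ≤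
      risk leb loss shat (s θ) :=
  lintegral_mono' (pi_mono_measure fun _ => commonPart_le_law hθ) le_rfl

/-- Two members of the family cannot both be close to the same function. -/
theorem le_l2DistSq_add_l2DistSq {φ : ℝ} (hφ : 0 < φ) (hφ6 : φ ≤ 1 / 6) {u : ℝ → ℝ}
    (hu : Measurable u) :
    ENNReal.ofReal (φ⁻¹ / 4) ≤ l2DistSq leb (s (1 / 3)) u + l2DistSq leb (s φ) u := by
  have hm : Measurable fun x => ENNReal.ofReal ((s (1 / 3) x - u x) ^ 2) :=
    (((measurable_s _).sub hu).pow_const 2).ennreal_ofReal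
  have h3 : φ ^ 3 ≤ (1 / 3) ^ 3 := by gcongr; linarith
  have h31 : φ ^ 3 ≤ 1 := h3.trans (by norm_num)
  rw [l2DistSq, l2DistSq, ← lintegral_add_left hm]
  calc ENNReal.ofReal (φ⁻¹ / 4)
      ≤ ENNReal.ofReal (((φ ^ 2)⁻¹ - 9) ^ 2 / 2) * leb (Icc 0 (φ ^ 3)) := by
        rw [leb_Icc h31, ← ENNReal.ofReal_mul (by positivity)]
        refine ENNReal.ofReal_le_ofReal ?_
        -- Here `9` is the value of `s (1/3)` on the spike of `s φ`; being at most a quarter of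
        -- `φ⁻²`, it leaves `(φ⁻² - 9)² ≥ (9/16) φ⁻⁴ ≥ φ⁻⁴ / 2`.
        have h9 : 9 ≤ (φ ^ 2)⁻¹ / 4 := by
          rw [le_div_iff₀ (by norm_num), le_inv_comm₀ (by norm_num) (by positivity)]
          norm_num
          nlinarith
        have e : φ⁻¹ / 4 = ((φ ^ 2)⁻¹ ^ 2 / 2) / 2 * φ ^ 3 := by field_simp; norm_num
        rw [e]
        gcongr ?_ * _
        nlinarith
    _ = ∫⁻ _ in Icc 0 (φ ^ 3), ENNReal.ofReal (((φ ^ 2)⁻¹ - 9) ^ 2 / 2) ∂leb :=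
        (setLIntegral_const _ _).symm
    _ ≤ ∫⁻ x in Icc 0 (φ ^ 3), (ENNReal.ofReal ((s (1 / 3) x - u x) ^ 2) +
          ENNReal.ofReal ((s φ x - u x) ^ 2)) ∂leb := by
        refine setLIntegral_mono' measurableSet_Icc fun x hx => ?_
        rw [← ENNReal.ofReal_add (sq_nonneg _) (sq_nonneg _), s_eq_first hx,
          s_eq_first ⟨hx.1, hx.2.trans h3⟩]
        refine ENNReal.ofReal_le_ofReal ?_
        norm_num
        nlinarith [sq_nonneg ((9 - u x) + ((φ ^ 2)⁻¹ - u x))]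
    _ ≤ _ := setLIntegral_le_lintegral _ _

theorem iSup_risk_l2_eq_top {n : ℕ} {stilde : (Fin n → ℝ) → ℝ → ℝ} (h : IsEstimator stilde) :
    (⨆ θ ∈ Ioc (0 : ℝ) (1 / 3), risk leb (l2DistSq leb) stilde (s θ)) = ⊤ := by
  set R := ⨆ θ ∈ Ioc (0 : ℝ) (1 / 3), risk leb (l2DistSq leb) stilde (s θ)
  set ν : Measure (Fin n → ℝ) := Measure.pi fun _ => commonPart with hν
  have hν0 : ν univ ≠ 0 := by
    rw [hν, Measure.pi_univ]
    exact Finset.prod_ne_zero_iff.2 fun _ _ => commonPart_univ_ne_zero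
  have hR : ∀ θ ∈ Ioc (0 : ℝ) (1 / 3), ∫⁻ ω, l2DistSq leb (s θ) (stilde ω) ∂ν ≤ R := fun θ hθ =>
    (lintegral_commonPart_le_risk _ _ hθ).trans (le_iSup₂_of_le θ hθ le_rfl)
  have hmeas : ∀ θ, Measurable fun ω => l2DistSq leb (s θ) (stilde ω) := fun θ => by
    exact Measurable.lintegral_prod_right' (f := fun p : (Fin n → ℝ) × ℝ =>
      ENNReal.ofReal ((s θ p.2 - stilde p.1 p.2) ^ 2)) ((((measurable_s θ).comp measurable_snd).sub h).pow_const 2).ennreal_ofReal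
  -- With `φ = 1 / (4m + 6)`, both `φ ≤ 1/6` and `φ⁻¹ / 4 ≥ m` hold.
  have hb : ∀ m : ℕ, (m : ℝ≥0∞) * ν univ ≤ R + R := fun m => by
    have hφ : 0 < (4 * m + 6 : ℝ)⁻¹ := by positivity
    have hφ6 : (4 * m + 6 : ℝ)⁻¹ ≤ 1 / 6 := by
      rw [one_div]; exact inv_anti₀ (by norm_num) (le_add_of_nonneg_left (by positivity))
    calc (m : ℝ≥0∞) * ν univ = ∫⁻ _, (m : ℝ≥0∞) ∂ν := (lintegral_const _).symm
      _ ≤ ∫⁻ ω, (l2DistSq leb (s (1 / 3)) (stilde ω) +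
            l2DistSq leb (s (4 * m + 6)⁻¹) (stilde ω)) ∂ν := by
          refine lintegral_mono fun ω => le_trans ?_ (le_l2DistSq_add_l2DistSq hφ hφ6
            (h.comp measurable_prodMk_left))
          rw [← ENNReal.ofReal_natCast, inv_inv]
          exact ENNReal.ofReal_le_ofReal (by linarith)
      _ ≤ R + R := by
          rw [lintegral_add_left (hmeas _)]
          exact add_le_add (hR _ ⟨by norm_num, le_rfl⟩) (hR _ ⟨hφ, by linarith⟩)
  by_contra hne
  obtain ⟨m, hm⟩ := ENNReal.exists_nat_mul_gt hν0 (ENNReal.add_ne_top.2 ⟨hne, hne⟩)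
  exact absurd hm (hb m).not_gt

/-! ### Masses of intervals and the exponential moment of a count. -/

/-- Only the part below `θ³` is used: `θ⁻² (θ³ - u³) ≥ θ - u`. -/
theorem le_law_Ioc {θ u v : ℝ} (hu : 0 ≤ u) (huθ : u < θ) (hθv : θ ≤ v) (hθ : θ ≤ 1) :
    ENNReal.ofReal (θ - u) ≤ law leb (s θ) (Ioc (u ^ 3) (v ^ 3)) := by
  have hθ0 : 0 < θ := hu.trans_lt huθ
  have hu3 : 0 ≤ u ^ 3 := by positivity
  rw [law, withDensity_apply _ measurableSet_Ioc]
  calc ENNReal.ofReal (θ - u)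
      ≤ ENNReal.ofReal (θ ^ 2)⁻¹ * leb (Ioc (u ^ 3) (θ ^ 3)) := by
        rw [leb_Ioc hu3 (pow_le_one₀ hθ0.le hθ), ← ENNReal.ofReal_mul (by positivity)]
        refine ENNReal.ofReal_le_ofReal ?_
        rw [inv_mul_eq_div, le_div_iff₀ (by positivity)]
        nlinarith [mul_nonneg (mul_nonneg hu (sub_nonneg.2 huθ.le)) (add_nonneg hu hθ0.le)]
    _ = ∫⁻ _ in Ioc (u ^ 3) (θ ^ 3), ENNReal.ofReal (θ ^ 2)⁻¹ ∂leb := (setLIntegral_const _ _).symm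
    _ ≤ ∫⁻ x in Ioc (u ^ 3) (θ ^ 3), ENNReal.ofReal (s θ x) ∂leb :=
        setLIntegral_mono' measurableSet_Ioc fun x hx => by
          rw [s_eq_first ⟨hu3.trans hx.1.le, hx.2⟩]
    _ ≤ _ := lintegral_mono_set (Ioc_subset_Ioc_right (by gcongr))

/-- Beyond `θ³` the density is at most `1`, and `v² + vu + u² ≤ 1/3` on `[0, 1/3]`. A grid step
`1/(3n)` thus brings at most `1/9` expected observations, against an average of at least `1/3` per
step on a grid interval ending at `θ`; the penalty `1/6` lies between. -/
theorem law_Ioc_le {θ u v : ℝ} (hθ : 0 < θ) (hθu : θ ≤ u) (huv : u ≤ v) (hv : v ≤ 1 / 3) :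
    law leb (s θ) (Ioc (u ^ 3) (v ^ 3)) ≤ ENNReal.ofReal ((v - u) / 3) := by
  have hu : 0 < u := hθ.trans_le hθu
  have hv1 : v ^ 3 ≤ 1 := pow_le_one₀ (hu.le.trans huv) (by linarith)
  rw [law, withDensity_apply _ measurableSet_Ioc]
  calc ∫⁻ x in Ioc (u ^ 3) (v ^ 3), ENNReal.ofReal (s θ x) ∂leb
      ≤ ∫⁻ _ in Ioc (u ^ 3) (v ^ 3), 1 ∂leb := by
        refine setLIntegral_mono' measurableSet_Ioc fun x hx => ?_
        have h3 : θ ^ 3 ≤ u ^ 3 := by gcongr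
        rw [s_eq_second ⟨h3.trans_lt hx.1, hx.2.trans hv1⟩]
        exact ENNReal.ofReal_le_one.2 (inv_le_one_of_one_le₀ (by nlinarith))
    _ ≤ ENNReal.ofReal ((v - u) / 3) := by
        rw [setLIntegral_one, leb_Ioc (by positivity) hv1]
        refine ENNReal.ofReal_le_ofReal ?_
        have h1 : v ^ 2 + v * u + u ^ 2 ≤ 1 / 3 := by nlinarith
        nlinarith [mul_le_mul_of_nonneg_left h1 (sub_nonneg.2 huv)]

/-- The exponential moment of the number of observations in a set. -/
theorem lintegral_exp_mul_sum_indicator_le {X : Type*} [MeasurableSpace X] (P : Measure X)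
    [IsProbabilityMeasure P] (n : ℕ) {A : Set X} (hA : MeasurableSet A) (c : ℝ) :
    ∫⁻ ω, ENNReal.ofReal (Real.exp (c * ∑ i, A.indicator (fun _ => (1 : ℝ)) (ω i)))
        ∂(Measure.pi fun _ : Fin n => P) ≤
      ENNReal.ofReal (Real.exp (n * ((Real.exp c - 1) * P.real A))) := by
  let f : X → ℝ≥0∞ := fun x => ENNReal.ofReal (Real.exp (c * A.indicator (fun _ => (1 : ℝ)) x))
  have hf : Measurable f :=
    ((measurable_const.mul (measurable_const.indicator hA)).exp).ennreal_ofReal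
  have hprod : ∀ ω : Fin n → X,
      ENNReal.ofReal (Real.exp (c * ∑ i, A.indicator (fun _ => (1 : ℝ)) (ω i))) =
        ∏ i, f (ω i) := fun ω => by
    rw [Finset.mul_sum, Real.exp_sum, ENNReal.ofReal_prod_of_nonneg fun _ _ => (Real.exp_pos _).le]
  have hindep := ProbabilityTheory.iIndepFun_pi (μ := fun _ : Fin n => P) (X := fun _ => f)
    fun _ => hf.aemeasurable
  have hone : ∫⁻ x, f x ∂P = ENNReal.ofReal (1 + (Real.exp c - 1) * P.real A) := by
    have hf' : ∀ x, f x = A.indicator (fun _ => ENNReal.ofReal (Real.exp c)) x +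
        Aᶜ.indicator (fun _ => 1) x := fun x => by
      by_cases hx : x ∈ A <;> simp [f, hx]
    simp only [hf']
    rw [lintegral_add_left (measurable_const.indicator hA), lintegral_indicator_const hA,
      lintegral_indicator_const hA.compl, one_mul, ← ofReal_measureReal, ← ofReal_measureReal,
      ← ENNReal.ofReal_mul (Real.exp_pos c).le, ← ENNReal.ofReal_add (by positivity) (by positivity),
      probReal_compl_eq_one_sub hA]
    congr 1
    ring
  simp only [hprod]
  rw [ProbabilityTheory.lintegral_prod_eq_prod_lintegral_of_indepFun _ _ hindep
    fun i => hf.comp (measurable_pi_apply i)]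
  have heval : ∀ i : Fin n, ∫⁻ ω, f (ω i) ∂(Measure.pi fun _ : Fin n => P) = ∫⁻ x, f x ∂P :=
    fun i => (measurePreserving_eval (fun _ : Fin n => P) i).lintegral_comp hf
  rw [Finset.prod_congr rfl fun i _ => heval i, Finset.prod_const, Finset.card_univ,
    Fintype.card_fin, hone, Real.exp_nat_mul, ENNReal.ofReal_pow (Real.exp_pos _).le]
  gcongr
  linarith [Real.add_one_le_exp ((Real.exp c - 1) * P.real A)]

/-! ### The penalized counting estimator. -/

/-- The candidate values of the parameter. -/
noncomputable def grid (n j : ℕ) : ℝ := j / (3 * n)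

/-- The criterion maximized by the estimator: a penalized number of observations in
`(-∞, (grid n j) ^ 3]`. -/
noncomputable def score {n : ℕ} (ω : Fin n → ℝ) (j : ℕ) : ℝ :=
  ∑ i, (Iic (grid n j ^ 3)).indicator (fun _ => (1 : ℝ)) (ω i) - j / 6

/-- `j` maximizes the criterion among `1, …, n`. -/
def IsBest {n : ℕ} (ω : Fin n → ℝ) (j : ℕ) : Prop :=
  j ∈ Finset.Icc 1 n ∧ ∀ i ∈ Finset.Icc 1 n, score ω i ≤ score ω j

theorem exists_isBest {n : ℕ} (hn : 1 ≤ n) (ω : Fin n → ℝ) : ∃ j, IsBest ω j :=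
  Finset.exists_max_image _ _ ⟨1, Finset.mem_Icc.2 ⟨le_rfl, hn⟩⟩

theorem measurable_score {n : ℕ} (j : ℕ) : Measurable fun ω : Fin n → ℝ => score ω j :=
  (Finset.measurable_sum _ fun i _ =>
    (measurable_const.indicator measurableSet_Iic).comp (measurable_pi_apply i)).sub_const _

theorem measurableSet_isBest {n : ℕ} (j : ℕ) : MeasurableSet {ω : Fin n → ℝ | IsBest ω j} := by
  have : {ω : Fin n → ℝ | IsBest ω j} = {_ω | j ∈ Finset.Icc 1 n} ∩
      ⋂ i ∈ Finset.Icc 1 n, {ω | score ω i ≤ score ω j} := by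
    ext ω; simp [IsBest]
  rw [this]
  exact (MeasurableSet.const _).inter (Finset.measurableSet_biInter _ fun i _ =>
    measurableSet_le (measurable_score i) (measurable_score j))

open Classical in
/-- The first maximizer of the criterion. -/
noncomputable def best {n : ℕ} (hn : 1 ≤ n) (ω : Fin n → ℝ) : ℕ := Nat.find (exists_isBest hn ω)

open Classical in
theorem isBest_best {n : ℕ} (hn : 1 ≤ n) (ω : Fin n → ℝ) : IsBest ω (best hn ω) :=
  Nat.find_spec (exists_isBest hn ω)

open Classical in
theorem measurable_best {n : ℕ} (hn : 1 ≤ n) : Measurable (best (n := n) hn) :=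
  measurable_find (exists_isBest hn) measurableSet_isBest

theorem grid_mono {n i j : ℕ} (hij : i ≤ j) : grid n i ≤ grid n j := by
  unfold grid; gcongr

theorem grid_le {n j : ℕ} (hj : j ∈ Finset.Icc 1 n) : grid n j ≤ 1 / 3 := by
  obtain ⟨h1, h2⟩ := Finset.mem_Icc.1 hj
  have h2' : (j : ℝ) ≤ n := by exact_mod_cast h2
  have : (0 : ℝ) < n := by exact_mod_cast h1.trans h2
  rw [grid, div_le_div_iff₀ (by positivity) (by norm_num)]
  linarith

theorem grid_nonneg (n j : ℕ) : 0 ≤ grid n j := by unfold grid; positivity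

theorem grid_pos {n j : ℕ} (hj : j ∈ Finset.Icc 1 n) : 0 < grid n j := by
  obtain ⟨h1, h2⟩ := Finset.mem_Icc.1 hj
  have : (0 : ℝ) < j := by exact_mod_cast h1
  have : (0 : ℝ) < n := by exact_mod_cast h1.trans h2
  unfold grid; positivity

theorem mul_grid {n : ℕ} (hn : 1 ≤ n) (j : ℕ) : n * grid n j = j / 3 := by
  have : (0 : ℝ) < n := by exact_mod_cast hn
  unfold grid; field_simp

theorem score_sub_score {n i j : ℕ} (hij : i ≤ j) (ω : Fin n → ℝ) :
    score ω j - score ω i =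
      ∑ l, (Ioc (grid n i ^ 3) (grid n j ^ 3)).indicator (fun _ => (1 : ℝ)) (ω l) -
        ((j : ℝ) - i) / 6 := by
  have h3 : grid n i ^ 3 ≤ grid n j ^ 3 :=
    pow_le_pow_left₀ (grid_nonneg n i) (grid_mono hij) 3
  have : ∀ x, (Ioc (grid n i ^ 3) (grid n j ^ 3)).indicator (fun _ => (1 : ℝ)) x =
      (Iic (grid n j ^ 3)).indicator (fun _ => (1 : ℝ)) x -
        (Iic (grid n i ^ 3)).indicator (fun _ => (1 : ℝ)) x := fun x => by
    rw [← Iic_sdiff_Iic, indicator_sdiff (Iic_subset_Iic.2 h3)]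
    rfl
  simp only [this, score, Finset.sum_sub_distrib]
  ring

/-! ### Concentration of the index and Hellinger risk. -/

/-- Markov's inequality for the exponential of a number of observations. -/
theorem measure_le_of_forall_mul_sum_indicator {X : Type*} [MeasurableSpace X] (P : Measure X)
    [IsProbabilityMeasure P] {n : ℕ} {A : Set X} (hA : MeasurableSet A) (c b : ℝ)
    {E : Set (Fin n → X)} (hE : MeasurableSet E)
    (h : ∀ ω ∈ E, 0 ≤ c * ∑ i, A.indicator (fun _ => (1 : ℝ)) (ω i) + b) :
    Measure.pi (fun _ : Fin n => P) E ≤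
      ENNReal.ofReal (Real.exp (n * ((Real.exp c - 1) * P.real A) + b)) := by
  calc Measure.pi (fun _ : Fin n => P) E
      = ∫⁻ _ in E, 1 ∂(Measure.pi fun _ : Fin n => P) := (setLIntegral_one _).symm
    _ ≤ ∫⁻ ω in E, ENNReal.ofReal (Real.exp b) * ENNReal.ofReal
          (Real.exp (c * ∑ i, A.indicator (fun _ => (1 : ℝ)) (ω i)))
          ∂(Measure.pi fun _ : Fin n => P) := by
        refine setLIntegral_mono' hE fun ω hω => ?_
        rw [← ENNReal.ofReal_mul (Real.exp_pos _).le, ← Real.exp_add, ENNReal.one_le_ofReal,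
          Real.one_le_exp_iff, add_comm]
        exact h ω hω
    _ ≤ ∫⁻ ω, ENNReal.ofReal (Real.exp b) * ENNReal.ofReal
          (Real.exp (c * ∑ i, A.indicator (fun _ => (1 : ℝ)) (ω i)))
          ∂(Measure.pi fun _ : Fin n => P) := setLIntegral_le_lintegral _ _
    _ ≤ ENNReal.ofReal (Real.exp b) *
          ENNReal.ofReal (Real.exp (n * ((Real.exp c - 1) * P.real A))) := by
        rw [lintegral_const_mul' _ _ ENNReal.ofReal_ne_top]
        gcongr
        exact lintegral_exp_mul_sum_indicator_le P n hA c
    _ = _ := by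
        rw [← ENNReal.ofReal_mul (Real.exp_pos _).le, ← Real.exp_add, add_comm]

theorem exp_half_le : Real.exp (1 / 2) ≤ 1.65 := by
  have h : Real.exp (1 / 2) ^ 2 = Real.exp 1 := by rw [← Real.exp_nat_mul]; norm_num
  nlinarith [Real.exp_one_lt_d9, Real.exp_pos (1 / 2)]

theorem exp_neg_half_le : Real.exp (-(1 / 2)) ≤ 5 / 8 := by
  have h : Real.exp (1 / 2) ^ 2 = Real.exp 1 := by rw [← Real.exp_nat_mul]; norm_num
  have h1 : 8 / 5 ≤ Real.exp (1 / 2) := by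
    nlinarith [Real.exp_one_gt_d9, Real.exp_pos (1 / 2)]
  rw [Real.exp_neg, inv_le_comm₀ (Real.exp_pos _) (by norm_num)]
  linarith

/-- The selected index concentrates around the index `k` of the true parameter. -/
theorem sampleLaw_best_eq_le {n : ℕ} (hn : 1 ≤ n) {θ : ℝ} (hθ : θ ∈ Ioc 0 (1 / 3)) {j k : ℕ}
    (hj : j ∈ Finset.Icc 1 n) (hk : k ∈ Finset.Icc 1 n) (hk1 : θ ≤ grid n k)
    (hk2 : (k : ℝ) / 3 < n * θ + 1 / 3) :
    sampleLaw leb n (s θ) {ω | best hn ω = j} ≤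
      ENNReal.ofReal (Real.exp (1 / 8 - |(j : ℝ) - k| / 100)) := by
  have := isProbabilityMeasure_law hθ.1 (hθ.2.trans (by norm_num))
  have hE : MeasurableSet {ω : Fin n → ℝ | best hn ω = j} :=
    measurable_best hn (measurableSet_singleton j)
  have hscore : ∀ ω : Fin n → ℝ, best hn ω = j → score ω k ≤ score ω j := fun ω h =>
    h ▸ (isBest_best hn ω).2 k hk
  have hn0 : (0 : ℝ) < n := by exact_mod_cast hn
  have hgj := mul_grid hn j
  have hgk := mul_grid hn k
  rcases lt_or_ge j k with hjk | hkj
  · have hjk' : (j : ℝ) + 1 ≤ k := by exact_mod_cast hjk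
    have hjθ : grid n j < θ := by
      have : (n : ℝ) * grid n j < n * θ := by rw [hgj]; linarith
      exact lt_of_mul_lt_mul_left this hn0.le
    -- The interval holds at most `(k - j)/6` observations, while `(k - 1 - j)/3` are expected at
    -- least. The exponent is at most `-(3/8)(k - 1 - j)/3 + (k - j)/12 = 1/8 - (k - j)/24`; the
    -- `1/8` pays for rounding `θ` up to the grid.
    refine (measure_le_of_forall_mul_sum_indicator (law leb (s θ))
      (measurableSet_Ioc (a := grid n j ^ 3) (b := grid n k ^ 3)) (-(1 / 2)) (((k : ℝ) - j) / 12) hE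
      fun ω hω => ?_).trans ?_
    · have h1 := score_sub_score hjk.le ω
      have h2 := hscore ω hω
      linarith
    · refine ENNReal.ofReal_le_ofReal (Real.exp_le_exp.2 ?_)
      have hp : θ - grid n j ≤ (law leb (s θ)).real (Ioc (grid n j ^ 3) (grid n k ^ 3)) :=
        (ENNReal.ofReal_le_iff_le_toReal (measure_ne_top _ _)).1
          (le_law_Ioc (grid_nonneg n j) hjθ hk1 (hθ.2.trans (by norm_num)))
      have h1 : ((k : ℝ) - 1 - j) / 3 ≤
          n * (law leb (s θ)).real (Ioc (grid n j ^ 3) (grid n k ^ 3)) := by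
        have := mul_le_mul_of_nonneg_left hp hn0.le
        linarith
      rw [abs_sub_comm, abs_of_nonneg (by linarith)]
      nlinarith [exp_neg_half_le]
  · have hkj' : (k : ℝ) ≤ j := by exact_mod_cast hkj
    -- Now at least `(j - k)/6` are observed and at most `(j - k)/9` expected. The exponent is at
    -- most `(0.65/9 - 1/12)(j - k) = -(j - k)/90`, whence the rate `1/100`.
    refine (measure_le_of_forall_mul_sum_indicator (law leb (s θ))
      (measurableSet_Ioc (a := grid n k ^ 3) (b := grid n j ^ 3)) (1 / 2) (-(((j : ℝ) - k) / 12)) hE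
      fun ω hω => ?_).trans ?_
    · have h1 := score_sub_score hkj ω
      have h2 := hscore ω hω
      linarith
    · refine ENNReal.ofReal_le_ofReal (Real.exp_le_exp.2 ?_)
      have hp : (law leb (s θ)).real (Ioc (grid n k ^ 3) (grid n j ^ 3)) ≤
          (grid n j - grid n k) / 3 :=
        ENNReal.toReal_le_of_le_ofReal
          (div_nonneg (sub_nonneg.2 (grid_mono hkj)) (by norm_num))
          (law_Ioc_le hθ.1 hk1 (grid_mono hkj) (grid_le hj))
      have h1 : n * (law leb (s θ)).real (Ioc (grid n k ^ 3) (grid n j ^ 3)) ≤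
          ((j : ℝ) - k) / 9 := by
        have := mul_le_mul_of_nonneg_left hp hn0.le
        linarith
      have h0 : 0 ≤ n * (law leb (s θ)).real (Ioc (grid n k ^ 3) (grid n j ^ 3)) := by positivity
      rw [abs_of_nonneg (by linarith)]
      nlinarith [exp_half_le]

/-- A bound for the contribution to the risk of an index at distance `|z|` of the optimal one. -/
noncomputable def weight (z : ℤ) : ℝ :=
  8 / 3 * (|(z : ℝ)| + 1) * Real.exp (1 / 8 - |(z : ℝ)| / 100)

theorem weight_nonneg (z : ℤ) : 0 ≤ weight z := by unfold weight; positivity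

theorem summable_weight : Summable weight := by
  have h : Summable fun m : ℕ => 8 / 3 * ((m : ℝ) + 1) * Real.exp (1 / 8 - (m : ℝ) / 100) := by
    have h1 := (Real.summable_pow_mul_exp_neg_nat_mul 1 (r := 1 / 100) (by norm_num)).add
      (Real.summable_pow_mul_exp_neg_nat_mul 0 (r := 1 / 100) (by norm_num))
    refine (h1.mul_left (8 / 3 * Real.exp (1 / 8))).congr fun m => ?_
    rw [show (1 / 8 - (m : ℝ) / 100) = 1 / 8 + -(1 / 100) * m by ring, Real.exp_add]
    ring
  refine Summable.of_nat_of_neg ?_ ?_ <;> simpa [weight] using h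

theorem hellinger_risk_le {n : ℕ} (hn : 1 ≤ n) {θ : ℝ} (hθ : θ ∈ Ioc 0 (1 / 3)) :
    risk leb (fun t u => (n : ℝ≥0∞) * hellingerSq leb t u) (fun ω => s (grid n (best hn ω))) (s θ) ≤
      ENNReal.ofReal (∑' z, weight z) := by
  have hn0 : (0 : ℝ) < n := by exact_mod_cast hn
  -- The index of the first grid point not below `θ`.
  set k : ℕ := ⌈3 * n * θ⌉₊ with hkdef
  have hx : 0 < 3 * n * θ := mul_pos (by positivity) hθ.1
  have hk : k ∈ Finset.Icc 1 n := by
    refine Finset.mem_Icc.2 ⟨Nat.ceil_pos.2 hx, Nat.ceil_le.2 ?_⟩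
    have := hθ.2
    nlinarith
  have hk2 := Nat.ceil_lt_add_one hx.le
  have hk1 := Nat.le_ceil (3 * n * θ)
  rw [← hkdef] at hk1 hk2
  have hk1' : θ ≤ grid n k := by rw [grid, le_div_iff₀ (by positivity)]; linarith
  have hloss : ∀ j ∈ Finset.Icc 1 n, (n : ℝ≥0∞) * hellingerSq leb (s θ) (s (grid n j)) ≤
      ENNReal.ofReal (8 / 3 * (|(j : ℝ) - k| + 1)) := fun j hj => by
    have h1 := hellingerSq_s_le (θ := θ) (φ := grid n j) ⟨hθ.1, hθ.2.trans (by norm_num)⟩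
      ⟨grid_pos hj, (grid_le hj).trans (by norm_num)⟩
    refine (mul_le_mul_right h1 _).trans ?_
    rw [← ENNReal.ofReal_natCast, ← ENNReal.ofReal_mul hn0.le]
    refine ENNReal.ofReal_le_ofReal ?_
    have h2 : n * |θ - grid n j| ≤ (|(j : ℝ) - k| + 1) / 3 := by
      rw [← abs_of_pos hn0, ← abs_mul, mul_sub, mul_grid hn, abs_le]
      have := abs_le.1 (le_refl |(j : ℝ) - k|)
      constructor <;> linarith
    linarith
  have hmeas : ∀ j, MeasurableSet {ω : Fin n → ℝ | best hn ω = j} := fun j =>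
    measurable_best hn (measurableSet_singleton j)
  calc risk leb (fun t u => (n : ℝ≥0∞) * hellingerSq leb t u)
        (fun ω => s (grid n (best hn ω))) (s θ)
      ≤ ∫⁻ ω, ∑ j ∈ Finset.Icc 1 n, {ω | best hn ω = j}.indicator
          (fun _ => ENNReal.ofReal (8 / 3 * (|(j : ℝ) - k| + 1))) ω ∂(sampleLaw leb n (s θ)) := by
        refine lintegral_mono fun ω => ?_
        have hb := (isBest_best hn ω).1
        refine (hloss _ hb).trans ?_
        refine le_trans ?_ (Finset.single_le_sum (fun _ _ => zero_le) hb)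
        rw [indicator_of_mem (by simp)]
    _ = ∑ j ∈ Finset.Icc 1 n, ENNReal.ofReal (8 / 3 * (|(j : ℝ) - k| + 1)) *
          sampleLaw leb n (s θ) {ω | best hn ω = j} := by
        rw [lintegral_finsetSum _ fun j _ => measurable_const.indicator (hmeas j)]
        exact Finset.sum_congr rfl fun j _ => lintegral_indicator_const (hmeas j) _
    _ ≤ ∑ j ∈ Finset.Icc 1 n, ENNReal.ofReal (weight ((j : ℤ) - k)) := by
        refine Finset.sum_le_sum fun j hj => ?_
        refine (mul_le_mul_right (sampleLaw_best_eq_le hn hθ hj hk hk1' (by linarith)) _).trans ?_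
        rw [← ENNReal.ofReal_mul (by positivity)]
        simp [weight]
    _ ≤ ∑' j : ℕ, ENNReal.ofReal (weight ((j : ℤ) - k)) := ENNReal.sum_le_tsum _
    -- Summing over all integer offsets removes the dependence on `n` and `k`.
    _ ≤ ∑' z, ENNReal.ofReal (weight z) :=
        ENNReal.tsum_comp_le_tsum_of_injective (f := fun j : ℕ => (j : ℤ) - k)
          (fun a b h => by simpa using h) _
    _ = ENNReal.ofReal (∑' z, weight z) :=
        (ENNReal.ofReal_tsum_of_nonneg weight_nonneg summable_weight).symm

theorem isEstimator_comp {n : ℕ} {f : ℝ → ℝ → ℝ} (hf : Measurable (Function.uncurry f))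
    {g : (Fin n → ℝ) → ℝ} (hg : Measurable g) : IsEstimator fun ω => f (g ω) :=
  hf.comp ((hg.comp measurable_fst).prodMk measurable_snd)

theorem isEstimator_best {n : ℕ} (hn : 1 ≤ n) :
    IsEstimator fun ω : Fin n → ℝ => s (grid n (best hn ω)) :=
  isEstimator_comp measurable_uncurry_s
    ((measurable_from_nat (f := grid n)).comp (measurable_best hn))

end DensityEstimation

theorem mainTheorem9 :
    (∀ θ ∈ Set.Ioc (0 : ℝ) (1 / 3), DensityEstimation.IsDensity DensityEstimation.leb
      (DensityEstimation.s θ)) ∧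
    (∃ C : ℝ≥0, ∀ n : ℕ, 1 ≤ n → ∃ shat : (Fin n → ℝ) → ℝ → ℝ,
      DensityEstimation.IsEstimator shat ∧
      (∀ ω, DensityEstimation.IsDensity DensityEstimation.leb (shat ω)) ∧
      (⨆ θ ∈ Set.Ioc (0 : ℝ) (1 / 3),
        DensityEstimation.risk DensityEstimation.leb
          (fun t u => (n : ℝ≥0∞) * DensityEstimation.hellingerSq DensityEstimation.leb t u)
          shat (DensityEstimation.s θ)) ≤ (C : ℝ≥0∞)) ∧
    DensityEstimation.MetricDimLE DensityEstimation.familyL2 2 ∧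
    (∀ n : ℕ, 1 ≤ n → ∀ stilde : (Fin n → ℝ) → ℝ → ℝ,
      DensityEstimation.IsEstimator stilde →
      (⨆ θ ∈ Set.Ioc (0 : ℝ) (1 / 3),
        DensityEstimation.risk DensityEstimation.leb
          (DensityEstimation.l2DistSq DensityEstimation.leb)
          stilde (DensityEstimation.s θ)) = ⊤) := by
  refine ⟨fun θ hθ => DensityEstimation.isDensity_s hθ.1 (hθ.2.trans (by norm_num)),
    ⟨(∑' z, DensityEstimation.weight z).toNNReal, fun n hn =>
      ⟨_, DensityEstimation.isEstimator_best hn, fun ω => ?_, ?_⟩⟩,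
    DensityEstimation.metricDimLE_familyL2, fun n _ _ h => DensityEstimation.iSup_risk_l2_eq_top h⟩
  · have hb := (DensityEstimation.isBest_best hn ω).1
    exact DensityEstimation.isDensity_s (DensityEstimation.grid_pos hb)
      ((DensityEstimation.grid_le hb).trans (by norm_num))
  · exact iSup₂_le fun θ hθ => DensityEstimation.hellinger_risk_le hn hθ
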